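/- Let $1<p<\infty$, let $\mu$ be Lebesgue measure on $[0,1]$, and let $L_p=L_p([0,1],\mu)$ (real or complex scalars). For a measurable set $A\subseteq[0,1]$ let $P_A\colon L_p\to L_p$ be the projection $P_Ax=\chi_A x$. Let $T\colon L_p\to L_p$ be a bounded linear operator that is $\ell_p$-singular, i.e. the restriction of $T$ to a subspace of $L_p$ linearly isomorphic to $\ell_p$ is never an isomorphism onto its image. Then: 1. If $p<2$, then for every $\varepsilon>0$ there is $\delta>0$ such that $\|P_AT\|\le\varepsilon$ for every measurable $A\subseteq[0,1]$ with $\mu(A)<\delta$. 2. If $p\ge 2$, then for every $\varepsilon>0$ there is $\delta>0$ such that $\|TP_A\|\le\varepsilon$ for every measurable $A\subseteq[0,1]$ with $\mu(A)<\delta$. -/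

import Mathlib

open MeasureTheory
open scoped ENNReal unitInterval

/-- A bounded operator `T : Y → Z` is `X`-singular if it is not an isomorphism (onto its image)
when restricted to any subspace `S` of `Y` that is linearly isomorphic to `X`; being an isomorphism
on `S` means being bounded below on `S`. -/
def IsSingularFor (𝕜 X : Type*) {Y Z : Type*} [NontriviallyNormedField 𝕜]
    [NormedAddCommGroup X] [NormedSpace 𝕜 X] [NormedAddCommGroup Y] [NormedSpace 𝕜 Y]
    [NormedAddCommGroup Z] [NormedSpace 𝕜 Z] (T : Y →L[𝕜] Z) : Prop :=
  ∀ S : Submodule 𝕜 Y, Nonempty (X ≃L[𝕜] S) →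
    ¬ ∃ c : ℝ, 0 < c ∧ ∀ y ∈ S, c * ‖y‖ ≤ ‖T y‖

/-- The sequence space `ℓ_p` of `p`-summable scalar sequences. -/
abbrev SeqLp (𝕜 : Type*) [RCLike 𝕜] (p : ℝ≥0∞) : Type _ := lp (fun _ : ℕ => 𝕜) p

/-- The space `L_p = L_p([0,1])` with respect to Lebesgue measure. -/
abbrev UnitLp (𝕜 : Type*) [RCLike 𝕜] (p : ℝ≥0∞) : Type _ := Lp 𝕜 p (volume : Measure I)

/-- The class `χ_A f` in `L_p`, for `f` in `L_p` and a measurable set `A ⊆ [0,1]`. -/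
noncomputable def bandMul {𝕜 : Type*} [RCLike 𝕜] {p : ℝ≥0∞}
    {A : Set I} (hA : MeasurableSet A) (f : UnitLp 𝕜 p) : UnitLp 𝕜 p :=
  ((Lp.memLp f).indicator hA).toLp (A.indicator (f : I → 𝕜))

theorem bandMul_coeFn {𝕜 : Type*} [RCLike 𝕜] {p : ℝ≥0∞}
    {A : Set I} (hA : MeasurableSet A) (f : UnitLp 𝕜 p) :
    (bandMul hA f : I → 𝕜) =ᵐ[volume] A.indicator (f : I → 𝕜) := by
  unfold bandMul
  exact MemLp.coeFn_toLp _

theorem bandMul_add {𝕜 : Type*} [RCLike 𝕜] {p : ℝ≥0∞}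
    {A : Set I} (hA : MeasurableSet A) (f g : UnitLp 𝕜 p) :
    bandMul hA (f + g) = bandMul hA f + bandMul hA g := by
  apply Lp.ext
  filter_upwards [bandMul_coeFn hA (f + g), bandMul_coeFn hA f, bandMul_coeFn hA g,
    Lp.coeFn_add f g, Lp.coeFn_add (bandMul hA f) (bandMul hA g)] with t h1 h2 h3 h4 h5
  rw [h5, Pi.add_apply, h1, h2, h3]
  by_cases h : t ∈ A
  · simp only [Set.indicator_of_mem h, h4, Pi.add_apply]
  · simp only [Set.indicator_of_notMem h, add_zero]

theorem bandMul_smul {𝕜 : Type*} [RCLike 𝕜] {p : ℝ≥0∞}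
    {A : Set I} (hA : MeasurableSet A) (c : 𝕜) (f : UnitLp 𝕜 p) :
    bandMul hA (c • f) = c • bandMul hA f := by
  apply Lp.ext
  filter_upwards [bandMul_coeFn hA (c • f), bandMul_coeFn hA f,
    Lp.coeFn_smul c f, Lp.coeFn_smul c (bandMul hA f)] with t h1 h2 h4 h5
  rw [h5, Pi.smul_apply, h1, h2]
  by_cases h : t ∈ A
  · simp only [Set.indicator_of_mem h, h4, Pi.smul_apply]
  · simp only [Set.indicator_of_notMem h, smul_zero]

theorem norm_bandMul_le {𝕜 : Type*} [RCLike 𝕜] {p : ℝ≥0∞}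
    {A : Set I} (hA : MeasurableSet A) (f : UnitLp 𝕜 p) : ‖bandMul hA f‖ ≤ ‖f‖ := by
  refine Lp.norm_le_norm_of_ae_le ?_
  filter_upwards [bandMul_coeFn hA f] with t ht
  rw [ht]
  exact norm_indicator_le_norm_self _ _

/-- The band projection `P_A : L_p → L_p`, `x ↦ χ_A x`, for a measurable set `A ⊆ [0,1]`. -/
noncomputable def bandProj (𝕜 : Type*) [RCLike 𝕜] (p : ℝ≥0∞) [Fact (1 ≤ p)]
    {A : Set I} (hA : MeasurableSet A) : UnitLp 𝕜 p →L[𝕜] UnitLp 𝕜 p :=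
  LinearMap.mkContinuous
    { toFun := bandMul hA
      map_add' := bandMul_add hA
      map_smul' := bandMul_smul hA }
    1 (fun f => (norm_bandMul_le hA f).trans_eq (one_mul _).symm)

open Filter Topology

/-! The proof is by contraposition: if smallness fails, `T` is bounded below on a copy of `ℓ_p`. The
criterion is `not_isSingularFor_of_factor`: if `Φ T V` is an operator on `ℓ_p` with diagonal bounded
away from zero, a sparse subsequence of unit vectors makes the off-diagonal part negligible, so `T`
is an isomorphism on the image of their span.

For `p = 2` such a factorization comes from disjoint functions with large images and a Hilbert
adjoint. For `p ≠ 2` it suffices that `T` stays large between pairs of bands of arbitrarily small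
measure (`not_isSingularFor_of_small_bands`): both families can be made disjoint, and disjoint
functions and disjoint bands give `V` and `Φ`.

Failure of the conclusion provides smallness on one side only: sources if `p ≥ 2`, targets if `p <
2`. For `p ≠ 2` the other side comes from comparison with `L_2`. Signed sums of `N` terms grow there
at most like `N ^ (1 / p)` if `p > 2`, or dually like `N ^ (1 - 1 / p)` if `p < 2`; both exponents
are below `1 / 2`, whereas vectors of a Hilbert space bounded away from zero have signed sums of
order at least `√N`. So some term is small in `L_2`, and the mass responsible for the large `L_p`
norm must sit where a function is large, which is a set of small measure. -/

/-! ### Operators on `ℓ_p` with large diagonal -/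

/-- A sequence with an upper `ℓ_p` estimate induces a bounded operator on `ℓ_p`. -/
theorem exists_clm_of_upper_estimate {𝕜 X : Type*} [RCLike 𝕜] {p : ℝ≥0∞} [Fact (1 ≤ p)]
    (hp : p ≠ ∞) [NormedAddCommGroup X] [NormedSpace 𝕜 X] [CompleteSpace X] (v : ℕ → X) (C : ℝ)
    (hv : ∀ (F : Finset ℕ) (a : ℕ → 𝕜), ‖∑ n ∈ F, a n • v n‖ ≤
      C * ‖(∑ n ∈ F, lp.single p n (a n) : SeqLp 𝕜 p)‖) :
    ∃ V : SeqLp 𝕜 p →L[𝕜] X, ∀ a : SeqLp 𝕜 p, HasSum (fun n => a n • v n) (V a) := by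
  -- Enlarging the constant to `max C 1` makes it positive, so that it can be divided by.
  have hC : ∀ (F : Finset ℕ) (a : ℕ → 𝕜), ‖∑ n ∈ F, a n • v n‖ ≤
      max C 1 * ‖(∑ n ∈ F, lp.single p n (a n) : SeqLp 𝕜 p)‖ := fun F a =>
    (hv F a).trans (mul_le_mul_of_nonneg_right (le_max_left _ _) (norm_nonneg _))
  have hCpos : 0 < max C 1 := lt_max_of_lt_right one_pos
  have hsum : ∀ a : SeqLp 𝕜 p, Summable (fun n => a n • v n) := by
    intro a
    rw [summable_iff_vanishing_norm]
    intro ε hε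
    obtain ⟨s, hs⟩ := (summable_iff_vanishing_norm.1 (lp.hasSum_single hp a).summable)
      (ε / max C 1) (by positivity)
    refine ⟨s, fun t ht => (hC t a).trans_lt ?_⟩
    have := hs t ht
    rwa [lt_div_iff₀ hCpos, mul_comm] at this
  let W : SeqLp 𝕜 p →ₗ[𝕜] X :=
    { toFun := fun a => ∑' n, a n • v n
      map_add' := fun a b => by
        rw [← (hsum a).tsum_add (hsum b)]
        simp [add_smul]
      map_smul' := fun c a => by
        rw [RingHom.id_apply, ← (hsum a).tsum_const_smul c]
        simp [mul_smul] }
  refine ⟨W.mkContinuous (max C 1) fun a => ?_, fun a => (hsum a).hasSum⟩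
  refine le_of_tendsto_of_tendsto (hsum a).hasSum.norm
    ((lp.hasSum_single hp a).norm.const_mul (max C 1)) (Eventually.of_forall fun F => hC F a)

theorem lp_norm_sum_single_comp {𝕜 : Type*} [RCLike 𝕜] {p : ℝ≥0∞} (hp : 0 < p.toReal)
    {τ : ℕ → ℕ} (hτ : Function.Injective τ) (F : Finset ℕ) (a : ℕ → 𝕜) :
    ‖(∑ n ∈ F, lp.single p (τ n) (a n) : SeqLp 𝕜 p)‖ =
      ‖(∑ n ∈ F, lp.single p n (a n) : SeqLp 𝕜 p)‖ := by
  have h1 := lp.norm_sum_single (E := fun _ : ℕ => 𝕜) hp a F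
  have h2 := lp.norm_sum_single (E := fun _ : ℕ => 𝕜) hp
    (fun m => a (Function.invFun τ m)) (F.map ⟨τ, hτ⟩)
  simp only [Finset.sum_map, Function.Embedding.coeFn_mk, Function.leftInverse_invFun hτ _] at h2
  refine (Real.rpow_left_inj ?_ ?_ hp.ne').1 (h2.trans h1.symm) <;> exact lp.norm_nonneg' _

theorem lp_single_eq_smul {𝕜 : Type*} [RCLike 𝕜] {p : ℝ≥0∞} (n : ℕ) (c : 𝕜) :
    (lp.single p n c : SeqLp 𝕜 p) = c • (lp.single p n (1 : 𝕜) : SeqLp 𝕜 p) := by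
  rw [← lp.single_smul, smul_eq_mul, mul_one]

/-- The spread of `ℓ_p` along an injective map of the index set. -/
theorem exists_spread {𝕜 : Type*} [RCLike 𝕜] {p : ℝ≥0∞} [Fact (1 ≤ p)] (hp : p ≠ ∞)
    {τ : ℕ → ℕ} (hτ : Function.Injective τ) :
    ∃ J : SeqLp 𝕜 p →L[𝕜] SeqLp 𝕜 p, ∀ a : SeqLp 𝕜 p,
      HasSum (fun n => a n • (lp.single p (τ n) (1 : 𝕜) : SeqLp 𝕜 p)) (J a) := by
  have hp0 : 0 < p.toReal := ENNReal.toReal_pos (one_pos.trans_le Fact.out).ne' hp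
  refine exists_clm_of_upper_estimate hp _ 1 fun F a => ?_
  simp_rw [← lp_single_eq_smul]
  rw [one_mul, lp_norm_sum_single_comp hp0 hτ]

/-- Linear growth beats every power below one. Both the weak nullity of the unit vectors and the
bound on signed sums in Hilbert space rest on this. -/
theorem nonpos_of_mul_le_mul_rpow {ε C r : ℝ} (hr : r < 1)
    (h : ∀ N : ℕ, N * ε ≤ C * (N : ℝ) ^ r) : ε ≤ 0 := by
  by_contra! hε
  have ht : Tendsto (fun N : ℕ => (N : ℝ) ^ (1 - r)) atTop atTop :=
    (tendsto_rpow_atTop (sub_pos.2 hr)).comp tendsto_natCast_atTop_atTop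
  obtain ⟨N, hN, hN0⟩ := ((ht.eventually_gt_atTop (C / ε)).and (eventually_gt_atTop 0)).exists
  have hN1 : (0 : ℝ) < N := Nat.cast_pos.2 hN0
  rw [div_lt_iff₀ hε, Real.rpow_sub hN1, Real.rpow_one, div_mul_eq_mul_div,
    lt_div_iff₀ (Real.rpow_pos_of_pos hN1 _)] at hN
  exact (h N).not_gt hN

/-- The unit vectors of `ℓ_p` are weakly null when `1 < p < ∞`. -/
theorem tendsto_clm_single {𝕜 : Type*} [RCLike 𝕜] {p : ℝ≥0∞} [Fact (1 ≤ p)] (hp1 : 1 < p)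
    (hp : p ≠ ∞) (φ : SeqLp 𝕜 p →L[𝕜] 𝕜) :
    Tendsto (fun n => φ (lp.single p n (1 : 𝕜))) atTop (𝓝 0) := by
  have hp0 : 0 < p.toReal := ENNReal.toReal_pos (one_pos.trans hp1).ne' hp
  have hpr : 1 < p.toReal := by
    simpa using (ENNReal.toReal_lt_toReal ENNReal.one_ne_top hp).2 hp1
  rw [tendsto_zero_iff_norm_tendsto_zero]
  by_contra hcon
  rw [Metric.tendsto_atTop] at hcon
  push Not at hcon
  obtain ⟨ε, hε, hf⟩ := hcon
  have hinf : {n | ε ≤ ‖φ (lp.single p n (1 : 𝕜))‖}.Infinite := by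
    refine Set.infinite_of_forall_exists_gt fun N => ?_
    obtain ⟨n, hn, h⟩ := hf (N + 1)
    refine ⟨n, ?_, hn⟩
    simpa using h
  have key : ∀ N : ℕ, N * ε ≤ ‖φ‖ * (N : ℝ) ^ p.toReal⁻¹ := by
    intro N
    obtain ⟨F, hF, hN⟩ := hinf.exists_subset_card_eq N
    -- Conjugate phases, so that the values of `φ` add up without cancellation. Division by zero
    -- gives `0`, so the bound by `1` holds for every `n`.
    let a : ℕ → 𝕜 := fun n =>
      (starRingEnd 𝕜) (φ (lp.single p n (1 : 𝕜))) / (‖φ (lp.single p n (1 : 𝕜))‖ : 𝕜)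
    have ha : ∀ n, ‖a n‖ ≤ 1 := fun n => by
      simp only [a, norm_div, RCLike.norm_conj, RCLike.norm_ofReal, abs_norm]
      exact div_self_le_one _
    have h1 : φ (∑ n ∈ F, lp.single p n (a n)) =
        ((∑ n ∈ F, ‖φ (lp.single p n (1 : 𝕜))‖ : ℝ) : 𝕜) := by
      rw [map_sum, RCLike.ofReal_sum]
      refine Finset.sum_congr rfl fun n hn => ?_
      rw [lp_single_eq_smul, map_smul, smul_eq_mul]
      have h0 : (‖φ (lp.single p n (1 : 𝕜))‖ : 𝕜) ≠ 0 := by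
        have : 0 < ‖φ (lp.single p n (1 : 𝕜))‖ := hε.trans_le (hF hn)
        exact_mod_cast this.ne'
      simp only [a]
      rw [div_mul_eq_mul_div, RCLike.conj_mul, sq, mul_div_assoc, div_self h0, mul_one]
    have h2 : ‖(∑ n ∈ F, lp.single p n (a n) : SeqLp 𝕜 p)‖ ≤ (N : ℝ) ^ (p.toReal)⁻¹ := by
      rw [Real.le_rpow_inv_iff_of_pos (norm_nonneg _) (Nat.cast_nonneg _) hp0,
        lp.norm_sum_single hp0, ← hN, Finset.card_eq_sum_ones, Nat.cast_sum]
      refine Finset.sum_le_sum fun n _ => ?_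
      rw [Nat.cast_one]
      exact Real.rpow_le_one (norm_nonneg _) (ha n) hp0.le
    calc (N : ℝ) * ε = ∑ n ∈ F, ε := by rw [Finset.sum_const, hN, nsmul_eq_mul]
      _ ≤ ∑ n ∈ F, ‖φ (lp.single p n (1 : 𝕜))‖ := Finset.sum_le_sum fun n hn => hF hn
      _ ≤ ‖φ (∑ n ∈ F, lp.single p n (a n))‖ := by
        rw [h1, RCLike.norm_ofReal]
        exact le_abs_self _
      _ ≤ ‖φ‖ * ‖(∑ n ∈ F, lp.single p n (a n) : SeqLp 𝕜 p)‖ := φ.le_opNorm _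
      _ ≤ _ := mul_le_mul_of_nonneg_left h2 (norm_nonneg _)
  exact hε.not_ge (nonpos_of_mul_le_mul_rpow (inv_lt_one_of_one_lt₀ hpr) key)

/-- Extraction of a subsequence along which the off-diagonal entries of a matrix whose rows and
columns are null decay geometrically. -/
theorem exists_strictMono_offDiag_le {M : ℕ → ℕ → ℝ} (hrow : ∀ m, Tendsto (M m) atTop (𝓝 0))
    (hcol : ∀ n, Tendsto (fun m => M m n) atTop (𝓝 0)) {η : ℝ} (hη : 0 < η) :
    ∃ τ : ℕ → ℕ, StrictMono τ ∧ ∀ j k, j ≠ k → M (τ j) (τ k) ≤ η * (1 / 2) ^ j * (1 / 2) ^ k := by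
  -- The second coordinate is an exponent fixed at the time of choice. The greedy step does not know
  -- its own position, but strictly increasing exponents are at least the position.
  obtain ⟨f, -, hf⟩ := exists_seq_of_forall_finset_exists (α := ℕ × ℕ) (fun _ => True)
    (fun x y => x.1 < y.1 ∧ x.2 < y.2 ∧ M x.1 y.1 ≤ η * (1 / 2) ^ x.2 * (1 / 2) ^ y.2 ∧
      M y.1 x.1 ≤ η * (1 / 2) ^ y.2 * (1 / 2) ^ x.2) (by
    intro s _
    let b := s.sup Prod.snd + 1
    have hev : ∀ x ∈ s, ∀ᶠ n in atTop, x.1 < n ∧ M x.1 n ≤ η * (1 / 2) ^ x.2 * (1 / 2) ^ b ∧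
        M n x.1 ≤ η * (1 / 2) ^ b * (1 / 2) ^ x.2 := fun x _ =>
      (eventually_gt_atTop x.1).and (((hrow x.1).eventually_le_const (by positivity)).and
        ((hcol x.1).eventually_le_const (by positivity)))
    obtain ⟨n, hn⟩ := ((Finset.eventually_all s).2 hev).exists
    exact ⟨(n, b), trivial, fun x hx => ⟨(hn x hx).1,
      Nat.lt_succ_of_le (Finset.le_sup (f := Prod.snd) hx), (hn x hx).2⟩⟩)
  have hmono : StrictMono fun n => (f n).1 := fun m n h => (hf m n h).1
  have hpos : ∀ n, n ≤ (f n).2 := (strictMono_nat_of_lt_succ fun n =>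
    (hf n (n + 1) n.lt_succ_self).2.1 : StrictMono fun n => (f n).2).id_le
  have hpow : ∀ n, (1 / 2 : ℝ) ^ (f n).2 ≤ (1 / 2) ^ n := fun n =>
    pow_le_pow_of_le_one (by norm_num) (by norm_num) (hpos n)
  refine ⟨_, hmono, fun j k hjk => ?_⟩
  have hbd : η * (1 / 2) ^ (f j).2 * (1 / 2) ^ (f k).2 ≤ η * (1 / 2) ^ j * (1 / 2) ^ k := by
    have := hpow j
    have := hpow k
    gcongr
  rcases hjk.lt_or_gt with h | h
  · exact (hf j k h).2.2.1.trans hbd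
  · exact (hf k j h).2.2.2.trans hbd

/-- The unit vector of `ℓ_p` at `n`. -/
noncomputable abbrev unitVec (𝕜 : Type*) [RCLike 𝕜] (p : ℝ≥0∞) (n : ℕ) : SeqLp 𝕜 p :=
  lp.single p n (1 : 𝕜)

/-- An operator on `ℓ_p` whose diagonal is bounded away from zero is bounded below on the span of
a subsequence of the unit vectors. -/
theorem exists_spread_bounded_below {𝕜 : Type*} [RCLike 𝕜] {p : ℝ≥0∞} [Fact (1 ≤ p)] (hp1 : 1 < p)
    (hp : p ≠ ∞) (R : SeqLp 𝕜 p →L[𝕜] SeqLp 𝕜 p) {c : ℝ} (hc : 0 < c)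
    (hR : ∀ n, c ≤ ‖R (unitVec 𝕜 p n) n‖) :
    ∃ J : SeqLp 𝕜 p →L[𝕜] SeqLp 𝕜 p, ∀ a, c / 2 * ‖a‖ ≤ ‖R (J a)‖ := by
  have hp0 : 0 < p.toReal := ENNReal.toReal_pos (one_pos.trans hp1).ne' hp
  have hpr : 1 < p.toReal := by
    simpa using (ENNReal.toReal_lt_toReal ENNReal.one_ne_top hp).2 hp1
  -- Rows tend to zero by weak nullity of the unit vectors, columns because `R e_n` lies in `ℓ_p`.
  -- With `η = c / 8` the off-diagonal error in coordinate `j` is at most `c / 4 * ‖a‖ * 2 ^ (-j)`,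
  -- whose `ℓ_p` norm is at most `c / 2 * ‖a‖`.
  obtain ⟨τ, hτ, hoff⟩ := exists_strictMono_offDiag_le
    (M := fun m n => ‖R (unitVec 𝕜 p n) m‖)
    (fun m => by
      have := tendsto_clm_single hp1 hp ((lp.evalCLM 𝕜 (fun _ : ℕ => 𝕜) p m).comp R)
      rw [← norm_zero (E := 𝕜)]
      exact this.norm)
    (fun n => by
      have h := (lp.memℓp (R (unitVec 𝕜 p n))).summable hp0 |>.tendsto_atTop_zero
      have := h.rpow_const (p := p.toReal⁻¹) (Or.inr (inv_nonneg.2 hp0.le))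
      simpa [Real.rpow_rpow_inv (norm_nonneg _) hp0.ne', Real.zero_rpow (inv_pos.2 hp0).ne']
        using this)
    (η := c / 8) (by positivity)
  obtain ⟨J, hJ⟩ := exists_spread (𝕜 := 𝕜) hp hτ.injective
  refine ⟨J, fun a => ?_⟩
  have hcoord : ∀ j, c * ‖a j‖ ≤ ‖R (J a) (τ j)‖ + c / 4 * ‖a‖ * (1 / 2) ^ j := by
    intro j
    have hs : HasSum (fun n => a n * R (unitVec 𝕜 p (τ n)) (τ j)) (R (J a) (τ j)) := by
      have := (((lp.evalCLM 𝕜 (fun _ : ℕ => 𝕜) p (τ j)).comp R).hasSum (hJ a))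
      simp only [map_smul, smul_eq_mul] at this
      exact this
    have hs' := hs.sub (hasSum_ite_eq j (a j * R (unitVec 𝕜 p (τ j)) (τ j)))
    have hgeo : HasSum (fun n : ℕ => ‖a‖ * (c / 8 * (1 / 2) ^ j * (1 / 2) ^ n))
        (‖a‖ * (c / 8 * (1 / 2) ^ j * 2)) :=
      (hasSum_geometric_two.mul_left _).mul_left _
    have hle := hs'.norm_le_of_bounded hgeo (fun n => by
      split_ifs with h
      · subst h
        rw [sub_self, norm_zero]
        positivity
      · rw [sub_zero, norm_mul]
        exact mul_le_mul (lp.norm_apply_le_norm (one_pos.trans hp1).ne' a n)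
          (hoff j n (Ne.symm h)) (norm_nonneg _) (norm_nonneg _))
    have h1 : c * ‖a j‖ ≤ ‖a j * R (unitVec 𝕜 p (τ j)) (τ j)‖ := by
      rw [norm_mul, mul_comm]
      exact mul_le_mul_of_nonneg_left (hR _) (norm_nonneg _)
    have h2 := norm_sub_norm_le (a j * R (unitVec 𝕜 p (τ j)) (τ j)) (R (J a) (τ j))
    rw [norm_sub_rev] at h2
    linarith
  -- Minkowski's inequality applied to `hcoord`; only the coordinates `τ j` of `R (J a)` are used.
  have hmain : ‖(c : 𝕜) • a‖ ≤ ‖R (J a)‖ + c / 2 * ‖a‖ := by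
    refine lp.norm_le_of_forall_sum_le hp0 (by positivity) fun F => ?_
    rw [← Real.rpow_inv_le_iff_of_pos (Finset.sum_nonneg fun _ _ => by positivity)
      (by positivity) hp0]
    have hmink := Real.Lp_add_le_of_nonneg F hpr.le (f := fun j => ‖R (J a) (τ j)‖)
      (g := fun j => c / 4 * ‖a‖ * (1 / 2 : ℝ) ^ j) (fun _ _ => norm_nonneg _)
      (fun _ _ => by positivity)
    rw [one_div p.toReal] at hmink
    refine le_trans ?_ (hmink.trans (add_le_add ?_ ?_))
    · refine Real.rpow_le_rpow (Finset.sum_nonneg fun _ _ => by positivity)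
        (Finset.sum_le_sum fun j _ => ?_) (by positivity)
      refine Real.rpow_le_rpow (norm_nonneg _) ?_ hp0.le
      simpa [norm_smul, abs_of_pos hc] using hcoord j
    · rw [Real.rpow_inv_le_iff_of_pos (Finset.sum_nonneg fun _ _ => by positivity)
        (norm_nonneg _) hp0]
      have := lp.sum_rpow_le_norm_rpow hp0 (R (J a)) (F.map ⟨τ, hτ.injective⟩)
      simpa [Finset.sum_map] using this
    · rw [Real.rpow_inv_le_iff_of_pos (Finset.sum_nonneg fun _ _ => by positivity)
        (by positivity) hp0]
      calc ∑ j ∈ F, (c / 4 * ‖a‖ * (1 / 2 : ℝ) ^ j) ^ p.toReal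
          ≤ ∑ j ∈ F, (c / 4 * ‖a‖) ^ p.toReal * (1 / 2 : ℝ) ^ j := by
            refine Finset.sum_le_sum fun j _ => ?_
            rw [Real.mul_rpow (by positivity) (by positivity)]
            refine mul_le_mul_of_nonneg_left ?_ (by positivity)
            exact Real.rpow_le_self_of_le_one (by positivity)
              (pow_le_one₀ (by norm_num) (by norm_num)) hpr.le
        _ ≤ (c / 4 * ‖a‖) ^ p.toReal * 2 := by
            rw [← Finset.mul_sum]
            refine mul_le_mul_of_nonneg_left ?_ (by positivity)
            exact sum_le_hasSum _ (fun _ _ => by positivity) hasSum_geometric_two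
        _ ≤ (c / 4 * ‖a‖) ^ p.toReal * 2 ^ p.toReal := by
            refine mul_le_mul_of_nonneg_left ?_ (by positivity)
            exact Real.self_le_rpow_of_one_le (by norm_num) hpr.le
        _ = (c / 2 * ‖a‖) ^ p.toReal := by
            rw [← Real.mul_rpow (by positivity) (by positivity)]
            ring_nf
  rw [norm_smul, RCLike.norm_ofReal, abs_of_pos hc] at hmain
  linarith

/-- An operator through which an operator on `ℓ_p` with diagonal bounded away from zero factors
is not `ℓ_p`-singular. -/
theorem not_isSingularFor_of_factor {𝕜 X Y : Type*} [RCLike 𝕜] {p : ℝ≥0∞} [Fact (1 ≤ p)]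
    (hp1 : 1 < p) (hp : p ≠ ∞) [NormedAddCommGroup X] [NormedSpace 𝕜 X]
    [NormedAddCommGroup Y] [NormedSpace 𝕜 Y] (T : X →L[𝕜] Y) (V : SeqLp 𝕜 p →L[𝕜] X)
    (Φ : Y →L[𝕜] SeqLp 𝕜 p) {c : ℝ} (hc : 0 < c)
    (h : ∀ n, c ≤ ‖Φ (T (V (unitVec 𝕜 p n))) n‖) : ¬ IsSingularFor 𝕜 (SeqLp 𝕜 p) T := by
  obtain ⟨J, hJ⟩ := exists_spread_bounded_below hp1 hp (Φ.comp (T.comp V)) hc h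
  set W := V.comp J
  have hΦ : 0 < ‖Φ‖ + 1 := by positivity
  have hT : 0 < ‖T‖ + 1 := by positivity
  have hTW : ∀ a, c / 2 / (‖Φ‖ + 1) * ‖a‖ ≤ ‖T (W a)‖ := by
    intro a
    rw [div_mul_eq_mul_div, div_le_iff₀ hΦ]
    have h1 := Φ.le_opNorm (T (W a))
    have h2 := hJ a
    have h3 : (Φ.comp (T.comp V)) (J a) = Φ (T (W a)) := rfl
    rw [h3] at h2
    nlinarith [norm_nonneg (T (W a))]
  have hW : ∀ a, c / 2 / (‖Φ‖ + 1) / (‖T‖ + 1) * ‖a‖ ≤ ‖W a‖ := by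
    intro a
    rw [div_mul_eq_mul_div, div_le_iff₀ hT]
    have h1 := T.le_opNorm (W a)
    nlinarith [hTW a, norm_nonneg (W a)]
  have hk : 0 < c / 2 / (‖Φ‖ + 1) / (‖T‖ + 1) := by positivity
  set k := c / 2 / (‖Φ‖ + 1) / (‖T‖ + 1)
  have hinj : Function.Injective (W : SeqLp 𝕜 p →ₗ[𝕜] X) := by
    rw [injective_iff_map_eq_zero]
    intro a ha
    have h1 := hW a
    have h2 : W a = 0 := ha
    rw [h2, norm_zero] at h1
    exact norm_le_zero_iff.1 (nonpos_of_mul_nonpos_right h1 hk)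
  intro hsing
  refine hsing (LinearMap.range (W : SeqLp 𝕜 p →ₗ[𝕜] X))
    ⟨(LinearEquiv.ofInjective _ hinj).toContinuousLinearEquivOfBounds ‖W‖ k⁻¹
      (fun a => W.le_opNorm a) fun y => ?_⟩
    ⟨c / 2 / (‖Φ‖ + 1) / (‖W‖ + 1), by positivity, ?_⟩
  · obtain ⟨a, rfl⟩ := (LinearEquiv.ofInjective _ hinj).surjective y
    rw [LinearEquiv.symm_apply_apply, ← div_eq_inv_mul, le_div_iff₀ hk, mul_comm]
    exact hW a
  · rintro _ ⟨a, rfl⟩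
    refine le_trans ?_ (hTW a)
    rw [div_mul_eq_mul_div, div_le_iff₀ (by positivity), mul_assoc]
    refine mul_le_mul_of_nonneg_left ?_ (by positivity)
    have := W.le_opNorm a
    have h2 := norm_nonneg a
    have h3 : ‖(W : SeqLp 𝕜 p →ₗ[𝕜] X) a‖ = ‖W a‖ := rfl
    rw [h3]
    linarith

/-! ### Band projections and disjoint supports -/

theorem toReal_pos_of_fact {p : ℝ≥0∞} [Fact (1 ≤ p)] (hp : p ≠ ∞) : 0 < p.toReal :=
  ENNReal.toReal_pos (one_pos.trans_le Fact.out).ne' hp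

theorem bandProj_coeFn {𝕜 : Type*} [RCLike 𝕜] {p : ℝ≥0∞} [Fact (1 ≤ p)]
    {A : Set I} (hA : MeasurableSet A) (f : UnitLp 𝕜 p) :
    (bandProj 𝕜 p hA f : I → 𝕜) =ᵐ[volume] A.indicator (f : I → 𝕜) :=
  bandMul_coeFn hA f

theorem norm_bandProj_apply_le {𝕜 : Type*} [RCLike 𝕜] {p : ℝ≥0∞} [Fact (1 ≤ p)]
    {A : Set I} (hA : MeasurableSet A) (f : UnitLp 𝕜 p) : ‖bandProj 𝕜 p hA f‖ ≤ ‖f‖ :=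
  norm_bandMul_le hA f

theorem norm_bandProj_sub_bandProj_diff_le {𝕜 : Type*} [RCLike 𝕜] {p : ℝ≥0∞} [Fact (1 ≤ p)]
    {A C : Set I} (hA : MeasurableSet A) (hC : MeasurableSet C) (f : UnitLp 𝕜 p) :
    ‖bandProj 𝕜 p hA f - bandProj 𝕜 p (hA.diff hC) f‖ ≤ ‖bandProj 𝕜 p hC f‖ := by
  refine Lp.norm_le_norm_of_ae_le ?_
  filter_upwards [bandProj_coeFn hA f, bandProj_coeFn (hA.diff hC) f, bandProj_coeFn hC f,
    Lp.coeFn_sub (bandProj 𝕜 p hA f) (bandProj 𝕜 p (hA.diff hC) f)] with t h1 h2 h3 h4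
  rw [h4, Pi.sub_apply, h1, h2, h3]
  by_cases ha : t ∈ A <;> by_cases hc : t ∈ C <;> simp [ha, hc]

/-- Absolute continuity of the integral of `|f| ^ p`. -/
theorem exists_norm_bandProj_le {𝕜 : Type*} [RCLike 𝕜] {p : ℝ≥0∞} [Fact (1 ≤ p)] (hp : p ≠ ∞)
    (f : UnitLp 𝕜 p) {η : ℝ} (hη : 0 < η) :
    ∃ δ : ℝ≥0∞, 0 < δ ∧ ∀ (C : Set I) (hC : MeasurableSet C), volume C ≤ δ →
      ‖bandProj 𝕜 p hC f‖ ≤ η := by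
  obtain ⟨δ, hδ, h⟩ := (Lp.memLp f).eLpNorm_indicator_le Fact.out hp hη
  refine ⟨ENNReal.ofReal δ, ENNReal.ofReal_pos.2 hδ, fun C hC hle => ?_⟩
  rw [Lp.norm_def, eLpNorm_congr_ae (bandProj_coeFn hC f)]
  exact ENNReal.toReal_le_of_le_ofReal hη.le (h C hC hle)

theorem enorm_rpow_eq_lintegral {𝕜 : Type*} [RCLike 𝕜] {p : ℝ≥0∞} [Fact (1 ≤ p)] (hp : p ≠ ∞)
    (f : UnitLp 𝕜 p) : ‖f‖ₑ ^ p.toReal = ∫⁻ t, ‖f t‖ₑ ^ p.toReal := by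
  have hp0 := toReal_pos_of_fact hp
  rw [Lp.enorm_def, eLpNorm_eq_lintegral_rpow_enorm_toReal (one_pos.trans_le Fact.out).ne' hp,
    one_div, ENNReal.rpow_inv_rpow hp0.ne']

theorem measurable_enorm_rpow {𝕜 : Type*} [RCLike 𝕜] {p : ℝ≥0∞} (f : UnitLp 𝕜 p) (r : ℝ) :
    Measurable fun t => ‖f t‖ₑ ^ r :=
  ((Lp.stronglyMeasurable f).measurable.enorm).pow_const r

/-- The norms of the pieces of `f` on disjoint sets. -/
theorem sum_norm_bandProj_rpow_le {𝕜 : Type*} [RCLike 𝕜] {p : ℝ≥0∞} [Fact (1 ≤ p)] (hp : p ≠ ∞)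
    {A : ℕ → Set I} (hA : ∀ n, MeasurableSet (A n)) (hd : Pairwise fun m n => Disjoint (A m) (A n))
    (f : UnitLp 𝕜 p) (F : Finset ℕ) :
    ∑ n ∈ F, ‖bandProj 𝕜 p (hA n) f‖ ^ p.toReal ≤ ‖f‖ ^ p.toReal := by
  have hp0 := toReal_pos_of_fact hp
  have key : ∑ n ∈ F, ‖bandProj 𝕜 p (hA n) f‖ₑ ^ p.toReal ≤ ‖f‖ₑ ^ p.toReal := by
    simp_rw [enorm_rpow_eq_lintegral hp]
    calc ∑ n ∈ F, ∫⁻ t, ‖bandProj 𝕜 p (hA n) f t‖ₑ ^ p.toReal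
        = ∑ n ∈ F, ∫⁻ t in A n, ‖f t‖ₑ ^ p.toReal := by
          refine Finset.sum_congr rfl fun n _ => ?_
          rw [← lintegral_indicator (hA n)]
          refine lintegral_congr_ae ?_
          filter_upwards [bandProj_coeFn (hA n) f] with t ht
          rw [ht]
          by_cases h : t ∈ A n <;> simp [h, hp0]
      _ = ∫⁻ t in ⋃ n ∈ F, A n, ‖f t‖ₑ ^ p.toReal :=
          (lintegral_biUnion_finset (fun m _ n _ hmn => hd hmn) (fun n _ => hA n) _).symm
      _ ≤ _ := setLIntegral_le_lintegral _ _
  have h2 := ENNReal.toReal_mono (ENNReal.rpow_ne_top_of_nonneg hp0.le enorm_ne_top) key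
  rw [ENNReal.toReal_sum fun n _ => ENNReal.rpow_ne_top_of_nonneg hp0.le enorm_ne_top] at h2
  simpa [← ENNReal.toReal_rpow] using h2

/-- Functions with disjoint supports satisfy an upper `p` estimate. -/
theorem norm_sum_smul_bandProj_le {𝕜 : Type*} [RCLike 𝕜] {p : ℝ≥0∞} [Fact (1 ≤ p)] (hp : p ≠ ∞)
    {A : ℕ → Set I} (hA : ∀ n, MeasurableSet (A n)) (hd : Pairwise fun m n => Disjoint (A m) (A n))
    {u : ℕ → UnitLp 𝕜 p} (hu : ∀ n, ‖u n‖ ≤ 1) (F : Finset ℕ) (a : ℕ → 𝕜) :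
    ‖∑ n ∈ F, a n • bandProj 𝕜 p (hA n) (u n)‖ ^ p.toReal ≤ ∑ n ∈ F, ‖a n‖ ^ p.toReal := by
  have hp0 := toReal_pos_of_fact hp
  set g := ∑ n ∈ F, a n • bandProj 𝕜 p (hA n) (u n) with hg
  have hgae : (g : I → 𝕜) =ᵐ[volume]
      fun t => ∑ n ∈ F, a n * (A n).indicator (u n : I → 𝕜) t := by
    have h1 : ∀ n, (a n • bandProj 𝕜 p (hA n) (u n) : UnitLp 𝕜 p) =ᵐ[volume]
        fun t => a n * (A n).indicator (u n : I → 𝕜) t := fun n => by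
      filter_upwards [Lp.coeFn_smul (a n) (bandProj 𝕜 p (hA n) (u n)),
        bandProj_coeFn (hA n) (u n)] with t h1 h2
      rw [h1, Pi.smul_apply, h2, smul_eq_mul]
    have h2 := Lp.coeFn_fun_finsetSum F fun n => a n • bandProj 𝕜 p (hA n) (u n)
    filter_upwards [h2, ae_all_iff.2 h1] with t h3 h4
    rw [hg, h3]
    exact Finset.sum_congr rfl fun n _ => h4 n
  have key : ‖g‖ₑ ^ p.toReal ≤ ∑ n ∈ F, ‖a n‖ₑ ^ p.toReal := by
    rw [enorm_rpow_eq_lintegral hp]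
    calc ∫⁻ t, ‖g t‖ₑ ^ p.toReal
        ≤ ∫⁻ t, ∑ n ∈ F, ‖a n‖ₑ ^ p.toReal * ‖u n t‖ₑ ^ p.toReal := by
          refine lintegral_mono_ae ?_
          filter_upwards [hgae] with t ht
          rw [ht]
          by_cases h : ∃ n ∈ F, t ∈ A n
          · obtain ⟨n, hn, htn⟩ := h
            rw [Finset.sum_eq_single_of_mem n hn, Set.indicator_of_mem htn, enorm_mul,
              ENNReal.mul_rpow_of_nonneg _ _ hp0.le]
            · exact Finset.single_le_sum
                (f := fun n => ‖a n‖ₑ ^ p.toReal * ‖u n t‖ₑ ^ p.toReal) (fun _ _ => zero_le) hn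
            · intro m _ hmn
              rw [Set.indicator_of_notMem (Set.disjoint_left.1 (hd hmn.symm) htn), mul_zero]
          · push Not at h
            rw [Finset.sum_eq_zero fun n hn => by
              rw [Set.indicator_of_notMem (h n hn), mul_zero]]
            simp [hp0]
      _ = ∑ n ∈ F, ‖a n‖ₑ ^ p.toReal * ‖u n‖ₑ ^ p.toReal := by
          rw [lintegral_finsetSum]
          · refine Finset.sum_congr rfl fun n _ => ?_
            rw [lintegral_const_mul _ (measurable_enorm_rpow _ _), enorm_rpow_eq_lintegral hp]
          · exact fun n _ => (measurable_enorm_rpow _ _).const_mul _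
      _ ≤ ∑ n ∈ F, ‖a n‖ₑ ^ p.toReal := by
          refine Finset.sum_le_sum fun n _ => mul_le_of_le_one_right' ?_
          refine ENNReal.rpow_le_one ?_ hp0.le
          rw [← ofReal_norm]
          exact ENNReal.ofReal_le_one.2 (hu n)
  have h2 := ENNReal.toReal_mono (ENNReal.sum_ne_top.2 fun n _ =>
    ENNReal.rpow_ne_top_of_nonneg hp0.le enorm_ne_top) key
  rw [ENNReal.toReal_sum fun n _ => ENNReal.rpow_ne_top_of_nonneg hp0.le enorm_ne_top] at h2
  simpa [← ENNReal.toReal_rpow] using h2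

/-! ### Inclusions, Chebyshev's inequality and truncation -/

/-- The contractive inclusion of `L_q` into `L_p` for `p ≤ q`. -/
theorem exists_inclusion (𝕜 : Type*) [RCLike 𝕜] {p q : ℝ≥0∞} [Fact (1 ≤ p)] [Fact (1 ≤ q)]
    (hpq : p ≤ q) : ∃ ι : UnitLp 𝕜 q →L[𝕜] UnitLp 𝕜 p,
      (∀ f, (ι f : I → 𝕜) =ᵐ[volume] f) ∧ ∀ f, ‖ι f‖ ≤ ‖f‖ := by
  have hm : ∀ f : UnitLp 𝕜 q, MemLp f p volume := fun f => (Lp.memLp f).mono_exponent hpq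
  have hc : ∀ f, ((hm f).toLp f : I → 𝕜) =ᵐ[volume] f := fun f => (hm f).coeFn_toLp
  have hn : ∀ f : UnitLp 𝕜 q, ‖(hm f).toLp f‖ ≤ ‖f‖ := fun f => by
    rw [Lp.norm_toLp, Lp.norm_def]
    exact ENNReal.toReal_mono (Lp.eLpNorm_ne_top f)
      (eLpNorm_le_eLpNorm_of_exponent_le hpq (Lp.aestronglyMeasurable f))
  let ι : UnitLp 𝕜 q →ₗ[𝕜] UnitLp 𝕜 p :=
    { toFun := fun f => (hm f).toLp f
      map_add' := fun f g => by
        refine Lp.ext ?_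
        filter_upwards [hc (f + g), hc f, hc g, Lp.coeFn_add f g,
          Lp.coeFn_add ((hm f).toLp f) ((hm g).toLp g)] with t h1 h2 h3 h4 h5
        rw [h1, h5, h4, Pi.add_apply, Pi.add_apply, h2, h3]
      map_smul' := fun c f => by
        refine Lp.ext ?_
        filter_upwards [hc (c • f), hc f, Lp.coeFn_smul c f,
          Lp.coeFn_smul c ((hm f).toLp f)] with t h1 h2 h4 h5
        rw [RingHom.id_apply, h1, h5, h4, Pi.smul_apply, Pi.smul_apply, h2] }
  exact ⟨ι.mkContinuous 1 fun f => (hn f).trans_eq (one_mul _).symm, hc, hn⟩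

theorem measurableSet_lt_norm {𝕜 : Type*} [RCLike 𝕜] {p : ℝ≥0∞} (f : UnitLp 𝕜 p) (c : ℝ) :
    MeasurableSet {t | c < ‖f t‖} :=
  measurableSet_lt measurable_const (Lp.stronglyMeasurable f).measurable.norm

theorem volume_lt_norm_le {𝕜 : Type*} [RCLike 𝕜] {p : ℝ≥0∞} [Fact (1 ≤ p)] (hp : p ≠ ∞)
    (f : UnitLp 𝕜 p) {c : ℝ} (hc : 0 < c) :
    volume {t | c < ‖f t‖} ≤ ENNReal.ofReal ((‖f‖ / c) ^ p.toReal) := by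
  have hp0 := toReal_pos_of_fact hp
  have h := meas_ge_le_mul_pow_eLpNorm_enorm volume (one_pos.trans_le Fact.out).ne' hp
    (Lp.aestronglyMeasurable f) (ε := ENNReal.ofReal c) (ENNReal.ofReal_pos.2 hc).ne'
    (fun h => absurd h ENNReal.ofReal_ne_top)
  refine (measure_mono fun t ht => ?_).trans (h.trans_eq ?_)
  · have : c < ‖f t‖ := ht
    rw [Set.mem_ofPred_eq, ← ofReal_norm]
    exact ENNReal.ofReal_le_ofReal this.le
  · rw [← ENNReal.mul_rpow_of_nonneg _ _ hp0.le, ← Lp.enorm_def, ← ofReal_norm,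
      ← ENNReal.ofReal_inv_of_pos hc, ← ENNReal.ofReal_mul (by positivity),
      ENNReal.ofReal_rpow_of_nonneg (by positivity) hp0.le, div_eq_inv_mul]

/-- The truncation of `f ∈ L_p` at level `c`, as an element of every `L_q`. -/
theorem exists_truncation {𝕜 : Type*} [RCLike 𝕜] {p : ℝ≥0∞} [Fact (1 ≤ p)] (q : ℝ≥0∞)
    [Fact (1 ≤ q)] (f : UnitLp 𝕜 p) {c : ℝ} (hc : 0 ≤ c) :
    ∃ g : UnitLp 𝕜 q, ‖g‖ ≤ c ∧
      ((f - bandProj 𝕜 p (measurableSet_lt_norm f c) f : UnitLp 𝕜 p) : I → 𝕜) =ᵐ[volume] g := by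
  set h := f - bandProj 𝕜 p (measurableSet_lt_norm f c) f
  have hb : ∀ᵐ t ∂(volume : Measure I), ‖h t‖ ≤ c := by
    filter_upwards [bandProj_coeFn (measurableSet_lt_norm f c) f,
      Lp.coeFn_sub f (bandProj 𝕜 p (measurableSet_lt_norm f c) f)] with t h1 h2
    rw [h2, Pi.sub_apply, h1]
    by_cases ht : c < ‖f t‖
    · rw [Set.indicator_of_mem (s := {t | c < ‖f t‖}) ht, sub_self, norm_zero]
      exact hc
    · rw [Set.indicator_of_notMem (s := {t | c < ‖f t‖}) ht, sub_zero]
      exact not_lt.1 ht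
  have hm : MemLp h q volume := MemLp.of_bound (Lp.aestronglyMeasurable h) c hb
  refine ⟨hm.toLp h, ?_, hm.coeFn_toLp.symm⟩
  have := Lp.norm_le_of_ae_bound (f := hm.toLp h) hc (by
    filter_upwards [hm.coeFn_toLp, hb] with t h1 h2
    rwa [h1])
  simpa [measureUnivNNReal] using this

theorem norm_sub_bandProj_le {𝕜 : Type*} [RCLike 𝕜] {p : ℝ≥0∞} [Fact (1 ≤ p)]
    (f : UnitLp 𝕜 p) {c : ℝ} (hc : 0 ≤ c) :
    ‖f - bandProj 𝕜 p (measurableSet_lt_norm f c) f‖ ≤ c := by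
  obtain ⟨g, hg, h⟩ := exists_truncation p f hc
  rwa [Lp.ext h]

/-! ### Making sets of small measure disjoint -/

/-- The tolerance `d` may depend on the chosen element, so each choice must bind all later ones.
Here `s` will be the measure of a set, and `d` the measure that may be removed without disturbing a
function attached to it. -/
theorem exists_seq_tsum_le {α : Type*} (s d : α → ℝ≥0∞) (hd : ∀ a, 0 < d a)
    (h : ∀ δ : ℝ≥0∞, 0 < δ → ∃ a, s a < δ) :
    ∃ x : ℕ → α, ∀ m, ∑' k, s (x (m + 1 + k)) ≤ d (x m) := by
  -- The second coordinate is the budget left for all later terms; each new term and its own budget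
  -- together fit into every earlier budget, so the sums telescope.
  obtain ⟨f, hf, hr⟩ := exists_seq_of_forall_finset_exists (α := α × ℝ≥0∞)
    (fun y => 0 < y.2 ∧ y.2 ≤ d y.1) (fun x y => s y.1 + y.2 ≤ x.2) (by
    intro F hF
    have hE : 0 < min 1 (F.inf Prod.snd) :=
      lt_min one_pos ((Finset.lt_inf_iff ENNReal.zero_lt_top).2 fun x hx => (hF x hx).1)
    set E := min 1 (F.inf Prod.snd)
    obtain ⟨a, ha⟩ := h (E / 2) (ENNReal.half_pos hE.ne')
    refine ⟨(a, min (d a) (E / 2)), ⟨lt_min (hd a) (ENNReal.half_pos hE.ne'), min_le_left _ _⟩,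
      fun x hx => ?_⟩
    calc s a + min (d a) (E / 2) ≤ E / 2 + E / 2 := add_le_add ha.le (min_le_right _ _)
      _ = E := ENNReal.add_halves E
      _ ≤ x.2 := (min_le_right _ _).trans (Finset.inf_le hx))
  refine ⟨fun n => (f n).1, fun m => le_trans ?_ (hf m).2⟩
  refine ENNReal.tsum_le_of_sum_range_le fun N => ?_
  have key : ∑ k ∈ Finset.range N, s (f (m + 1 + k)).1 + (f (m + N)).2 ≤ (f m).2 := by
    induction N with
    | zero => simp
    | succ N ih =>
      rw [Finset.sum_range_succ, add_assoc]
      refine le_trans ?_ ih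
      gcongr
      have := hr (m + N) (m + N + 1) (Nat.lt_succ_self _)
      rwa [show m + 1 + N = m + N + 1 by ring]
  exact le_self_add.trans key

/-- Each set loses all later ones, whose total measure is controlled by `exists_seq_tsum_le`. -/
theorem pairwise_disjoint_diff_iUnion (A : ℕ → Set I) :
    Pairwise fun m n => Disjoint (A m \ ⋃ k, A (m + 1 + k)) (A n \ ⋃ k, A (n + 1 + k)) := by
  have h : ∀ m n, m < n → Disjoint (A m \ ⋃ k, A (m + 1 + k)) (A n \ ⋃ k, A (n + 1 + k)) := by
    intro m n hmn
    refine Set.disjoint_left.2 fun t ht ht' => ht.2 (Set.mem_iUnion.2 ⟨n - (m + 1), ?_⟩)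
    rw [Nat.add_sub_cancel' (Nat.succ_le_of_lt hmn)]
    exact ht'.1
  intro m n hmn
  rcases hmn.lt_or_gt with h1 | h1
  · exact h m n h1
  · exact (h n m h1).symm

/-- From two families of sets of small measure one extracts sequences that become disjoint after
a modification that is negligible for prescribed functions. -/
theorem exists_disjoint_subseq {𝕜 : Type*} [RCLike 𝕜] {p : ℝ≥0∞} [Fact (1 ≤ p)] (hp : p ≠ ∞)
    {α : Type*} {A B : α → Set I} (hA : ∀ a, MeasurableSet (A a)) (hB : ∀ a, MeasurableSet (B a))
    (f g : α → UnitLp 𝕜 p)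
    (h : ∀ δ : ℝ≥0∞, 0 < δ → ∃ a, volume (A a) < δ ∧ volume (B a) < δ) {η : ℝ} (hη : 0 < η) :
    ∃ (x : ℕ → α) (A' B' : ℕ → Set I) (hA' : ∀ n, MeasurableSet (A' n))
      (hB' : ∀ n, MeasurableSet (B' n)),
      (Pairwise fun m n => Disjoint (A' m) (A' n)) ∧ (Pairwise fun m n => Disjoint (B' m) (B' n)) ∧
      (∀ n, A' n ⊆ A (x n)) ∧
      (∀ n, ‖bandProj 𝕜 p (hA (x n)) (f (x n)) - bandProj 𝕜 p (hA' n) (f (x n))‖ ≤ η) ∧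
      ∀ n, ‖bandProj 𝕜 p (hB (x n)) (g (x n)) - bandProj 𝕜 p (hB' n) (g (x n))‖ ≤ η := by
  choose d hd hdf using fun a => exists_norm_bandProj_le hp (f a) hη
  choose e he heg using fun a => exists_norm_bandProj_le hp (g a) hη
  obtain ⟨x, hx⟩ := exists_seq_tsum_le (fun a => max (volume (A a)) (volume (B a)))
    (fun a => min (d a) (e a)) (fun a => lt_min (hd a) (he a))
    (fun δ hδ => (h δ hδ).imp fun a ha => max_lt ha.1 ha.2)
  have hUA : ∀ n, MeasurableSet (⋃ k, A (x (n + 1 + k))) := fun n =>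
    MeasurableSet.iUnion fun k => hA _
  have hUB : ∀ n, MeasurableSet (⋃ k, B (x (n + 1 + k))) := fun n =>
    MeasurableSet.iUnion fun k => hB _
  refine ⟨x, fun n => A (x n) \ ⋃ k, A (x (n + 1 + k)), fun n => B (x n) \ ⋃ k, B (x (n + 1 + k)),
    fun n => (hA _).diff (hUA n), fun n => (hB _).diff (hUB n),
    pairwise_disjoint_diff_iUnion fun n => A (x n), pairwise_disjoint_diff_iUnion fun n => B (x n),
    fun n => Set.sdiff_subset, fun n => ?_, fun n => ?_⟩
  · refine (norm_bandProj_sub_bandProj_diff_le (hA _) (hUA n) _).trans (hdf _ _ (hUA n) ?_)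
    calc _ ≤ ∑' k, volume (A (x (n + 1 + k))) := measure_iUnion_le _
      _ ≤ _ := ENNReal.tsum_le_tsum fun k => le_max_left _ _
      _ ≤ _ := (hx n).trans (min_le_left _ _)
  · refine (norm_bandProj_sub_bandProj_diff_le (hB _) (hUB n) _).trans (heg _ _ (hUB n) ?_)
    calc _ ≤ ∑' k, volume (B (x (n + 1 + k))) := measure_iUnion_le _
      _ ≤ _ := ENNReal.tsum_le_tsum fun k => le_max_right _ _
      _ ≤ _ := (hx n).trans (min_le_right _ _)

/-! ### Factoring `ℓ_p` through disjoint bands -/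

/-- A bounded sequence of disjointly supported functions as the image of the unit vectors. -/
theorem exists_disjoint_synthesis {𝕜 : Type*} [RCLike 𝕜] {p : ℝ≥0∞} [Fact (1 ≤ p)] (hp : p ≠ ∞)
    {A : ℕ → Set I} (hA : ∀ n, MeasurableSet (A n)) (hd : Pairwise fun m n => Disjoint (A m) (A n))
    {u : ℕ → UnitLp 𝕜 p} (hu : ∀ n, ‖u n‖ ≤ 1) :
    ∃ V : SeqLp 𝕜 p →L[𝕜] UnitLp 𝕜 p, ∀ n, V (unitVec 𝕜 p n) = bandProj 𝕜 p (hA n) (u n) := by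
  have hp0 := toReal_pos_of_fact hp
  obtain ⟨V, hV⟩ := exists_clm_of_upper_estimate (𝕜 := 𝕜) hp
    (fun n => bandProj 𝕜 p (hA n) (u n)) 1 fun F a => by
      rw [one_mul, ← Real.rpow_le_rpow_iff (norm_nonneg _) (norm_nonneg _) hp0,
        lp.norm_sum_single hp0]
      exact norm_sum_smul_bandProj_le hp hA hd hu F a
  refine ⟨V, fun n => (hV (unitVec 𝕜 p n)).unique ?_⟩
  have := hasSum_single (f := fun m => (unitVec 𝕜 p n) m • bandProj 𝕜 p (hA m) (u m)) n
    fun m hm => by rw [lp.single_apply_ne _ _ _ hm, zero_smul]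
  simpa using this

/-- Contractive functionals on disjoint bands as the coordinates of an operator into `ℓ_p`. -/
theorem exists_disjoint_analysis {𝕜 : Type*} [RCLike 𝕜] {p : ℝ≥0∞} [Fact (1 ≤ p)] (hp : p ≠ ∞)
    {A : ℕ → Set I} (hA : ∀ n, MeasurableSet (A n)) (hd : Pairwise fun m n => Disjoint (A m) (A n))
    {ψ : ℕ → UnitLp 𝕜 p →L[𝕜] 𝕜} (hψ : ∀ n, ‖ψ n‖ ≤ 1) :
    ∃ Φ : UnitLp 𝕜 p →L[𝕜] SeqLp 𝕜 p, ∀ f n, Φ f n = ψ n (bandProj 𝕜 p (hA n) f) := by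
  have hp0 := toReal_pos_of_fact hp
  have hle : ∀ f (F : Finset ℕ), ∑ n ∈ F, ‖ψ n (bandProj 𝕜 p (hA n) f)‖ ^ p.toReal ≤
      ‖f‖ ^ p.toReal := fun f F => by
    refine le_trans (Finset.sum_le_sum fun n _ => ?_) (sum_norm_bandProj_rpow_le hp hA hd f F)
    refine Real.rpow_le_rpow (norm_nonneg _) ?_ hp0.le
    simpa using (ψ n).le_of_opNorm_le (hψ n) (bandProj 𝕜 p (hA n) f)
  let Φ : UnitLp 𝕜 p →ₗ[𝕜] SeqLp 𝕜 p :=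
    { toFun := fun f => ⟨fun n => ψ n (bandProj 𝕜 p (hA n) f), memℓp_gen' (hle f)⟩
      map_add' := fun f g => by
        ext n
        simp only [map_add]
        rfl
      map_smul' := fun c f => by
        ext n
        simp }
  exact ⟨Φ.mkContinuous 1 fun f => by
    rw [one_mul]
    exact lp.norm_le_of_forall_sum_le hp0 (norm_nonneg _) (hle f), fun f n => rfl⟩

/-- An operator that does not vanish between bands of small measure is not `ℓ_p`-singular. -/
theorem not_isSingularFor_of_small_bands {𝕜 : Type*} [RCLike 𝕜] {p : ℝ≥0∞} [Fact (1 ≤ p)]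
    (hp1 : 1 < p) (hp : p ≠ ∞) (T : UnitLp 𝕜 p →L[𝕜] UnitLp 𝕜 p) {c : ℝ} (hc : 0 < c)
    (h : ∀ δ : ℝ≥0∞, 0 < δ → ∃ (A B : Set I) (hA : MeasurableSet A) (hB : MeasurableSet B)
      (u : UnitLp 𝕜 p), volume A < δ ∧ volume B < δ ∧ ‖u‖ ≤ 1 ∧
        c ≤ ‖bandProj 𝕜 p hB (T (bandProj 𝕜 p hA u))‖) :
    ¬ IsSingularFor 𝕜 (SeqLp 𝕜 p) T := by
  have h' : ∀ δ : {δ : ℝ≥0∞ // 0 < δ}, _ := fun δ => h δ.1 δ.2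
  choose A B hA hB u hvA hvB hu hcu using h'
  -- Trimming the source costs `‖T‖ * η` and trimming the target costs `η`, together `c / 2`. The
  -- target is trimmed with respect to the image of the untrimmed source.
  have hη : 0 < c / (2 * (‖T‖ + 1)) := by positivity
  obtain ⟨x, A', B', hA', hB', hdA, hdB, -, hfA, hfB⟩ := exists_disjoint_subseq hp hA hB u
    (fun a => T (bandProj 𝕜 p (hA a) (u a))) (fun δ hδ => ⟨⟨δ, hδ⟩, hvA _, hvB _⟩) hη
  have hlow : ∀ n, c / 2 ≤ ‖bandProj 𝕜 p (hB' n) (T (bandProj 𝕜 p (hA' n) (u (x n))))‖ := by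
    intro n
    set w := u (x n)
    have h1 := hcu (x n)
    have h2 := hfB n
    have h3 : ‖bandProj 𝕜 p (hB' n) (T (bandProj 𝕜 p (hA (x n)) w)) -
        bandProj 𝕜 p (hB' n) (T (bandProj 𝕜 p (hA' n) w))‖ ≤ ‖T‖ * (c / (2 * (‖T‖ + 1))) := by
      rw [← map_sub, ← map_sub]
      exact (norm_bandProj_apply_le _ _).trans (T.le_opNorm_of_le (hfA n))
    have h4 : (‖T‖ + 1) * (c / (2 * (‖T‖ + 1))) = c / 2 := by field_simp
    have h5 := norm_sub_norm_le (bandProj 𝕜 p (hB (x n)) (T (bandProj 𝕜 p (hA (x n)) w)))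
      (bandProj 𝕜 p (hB' n) (T (bandProj 𝕜 p (hA (x n)) w)))
    have h6 := norm_sub_norm_le (bandProj 𝕜 p (hB' n) (T (bandProj 𝕜 p (hA (x n)) w)))
      (bandProj 𝕜 p (hB' n) (T (bandProj 𝕜 p (hA' n) w)))
    linarith
  choose ψ hψ hψe using fun n =>
    exists_dual_vector'' 𝕜 (bandProj 𝕜 p (hB' n) (T (bandProj 𝕜 p (hA' n) (u (x n)))))
  obtain ⟨V, hV⟩ := exists_disjoint_synthesis hp hA' hdA (fun n => hu (x n))
  obtain ⟨Φ, hΦ⟩ := exists_disjoint_analysis hp hB' hdB hψ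
  refine not_isSingularFor_of_factor hp1 hp T V Φ (half_pos hc) fun n => ?_
  rw [hΦ, hV, hψe, RCLike.norm_ofReal, abs_norm]
  exact hlow n

/-! ### Signed sums in Hilbert space -/

/-- The signs are chosen one at a time so that the cross term with the partial sum is nonnegative.
-/
theorem exists_signs_sum_sq_le {𝕜 H : Type*} [RCLike 𝕜] [NormedAddCommGroup H]
    [InnerProductSpace 𝕜 H] (y : ℕ → H) (N : ℕ) : ∃ s : ℕ → 𝕜, (∀ n, ‖s n‖ ≤ 1) ∧
      ∑ n ∈ Finset.range N, ‖y n‖ ^ 2 ≤ ‖∑ n ∈ Finset.range N, s n • y n‖ ^ 2 := by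
  induction N with
  | zero => exact ⟨0, by simp, by simp⟩
  | succ N ih =>
    obtain ⟨s, hs, hle⟩ := ih
    set z := ∑ n ∈ Finset.range N, s n • y n with hz
    have hup : ∀ c : 𝕜, ∑ n ∈ Finset.range (N + 1), Function.update s N c n • y n =
        z + c • y N := fun c => by
      rw [Finset.sum_range_succ, Function.update_self, hz]
      congr 1
      refine Finset.sum_congr rfl fun n hn => ?_
      rw [Function.update_of_ne (Finset.mem_range.1 hn).ne]
    have hb : ∀ c : 𝕜, ‖c‖ ≤ 1 → ∀ n, ‖Function.update s N c n‖ ≤ 1 := fun c hc n => by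
      by_cases h : n = N
      · rw [h, Function.update_self]
        exact hc
      · rw [Function.update_of_ne h]
        exact hs n
    rcases le_total 0 (RCLike.re (inner 𝕜 z (y N))) with h | h
    · refine ⟨Function.update s N 1, hb 1 (by simp), ?_⟩
      rw [hup, one_smul, Finset.sum_range_succ, norm_add_sq (𝕜 := 𝕜)]
      linarith
    · refine ⟨Function.update s N (-1), hb (-1) (by simp), ?_⟩
      rw [hup, neg_smul, one_smul, ← sub_eq_add_neg, Finset.sum_range_succ,
        norm_sub_sq (𝕜 := 𝕜)]
      linarith

/-- In an inner product space, a sequence whose signed sums grow slower than `√N` is not bounded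
away from zero. -/
theorem exists_norm_lt_of_signed_sums {𝕜 H : Type*} [RCLike 𝕜] [NormedAddCommGroup H]
    [InnerProductSpace 𝕜 H] (y : ℕ → H) {C r : ℝ} (hr : r < 1 / 2)
    (h : ∀ (N : ℕ) (s : ℕ → 𝕜), (∀ n, ‖s n‖ ≤ 1) →
      ‖∑ n ∈ Finset.range N, s n • y n‖ ≤ C * (N : ℝ) ^ r) {η : ℝ} (hη : 0 < η) :
    ∃ n, ‖y n‖ < η := by
  by_contra! hcon
  refine (pow_pos hη 2).not_ge (nonpos_of_mul_le_mul_rpow (C := C ^ 2) (r := r * 2)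
    (by linarith) fun N => ?_)
  obtain ⟨s, hs, hle⟩ := exists_signs_sum_sq_le (𝕜 := 𝕜) y N
  calc (N : ℝ) * η ^ 2 = ∑ n ∈ Finset.range N, η ^ 2 := by simp
    _ ≤ ∑ n ∈ Finset.range N, ‖y n‖ ^ 2 :=
      Finset.sum_le_sum fun n _ => pow_le_pow_left₀ hη.le (hcon n) 2
    _ ≤ _ := hle
    _ ≤ (C * (N : ℝ) ^ r) ^ 2 := pow_le_pow_left₀ (norm_nonneg _) (h N s hs) 2
    _ = C ^ 2 * (N : ℝ) ^ (r * 2) := by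
      rw [mul_pow, Real.rpow_mul (Nat.cast_nonneg N), Real.rpow_two]

/-! ### Disjoint sources and targets in the three ranges of `p` -/

/-- An operator that does not vanish on functions of small support has a large image on a
sequence of disjoint functions. -/
theorem exists_disjoint_sources {𝕜 : Type*} [RCLike 𝕜] {p : ℝ≥0∞} [Fact (1 ≤ p)]
    (hp : p ≠ ∞) (T : UnitLp 𝕜 p →L[𝕜] UnitLp 𝕜 p) {ε : ℝ} (hε : 0 < ε)
    (h : ∀ δ : ℝ≥0∞, 0 < δ → ∃ (A : Set I) (hA : MeasurableSet A) (u : UnitLp 𝕜 p),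
      volume A < δ ∧ ‖u‖ ≤ 1 ∧ ε ≤ ‖T (bandProj 𝕜 p hA u)‖) {δ : ℝ≥0∞} (hδ : 0 < δ) :
    ∃ (A : ℕ → Set I) (hA : ∀ n, MeasurableSet (A n)) (u : ℕ → UnitLp 𝕜 p),
      (Pairwise fun m n => Disjoint (A m) (A n)) ∧ (∀ n, volume (A n) < δ) ∧ (∀ n, ‖u n‖ ≤ 1) ∧
      ∀ n, ε / 2 ≤ ‖T (bandProj 𝕜 p (hA n) (u n))‖ := by
  -- Capping at `δ` keeps every selected set below the prescribed measure.
  have h' : ∀ γ : {γ : ℝ≥0∞ // 0 < γ}, _ := fun γ => h (min γ.1 δ) (lt_min γ.2 hδ)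
  choose A hA u hvA hu hεu using h'
  have hη : 0 < ε / (2 * (‖T‖ + 1)) := by positivity
  obtain ⟨x, A', -, hA', -, hd, -, hsub, hfA, -⟩ := exists_disjoint_subseq hp hA hA u u
    (fun γ hγ => ⟨⟨γ, hγ⟩, (hvA _).trans_le (min_le_left _ _),
      (hvA _).trans_le (min_le_left _ _)⟩) hη
  refine ⟨A', hA', fun n => u (x n), hd, fun n => (measure_mono (hsub n)).trans_lt
    ((hvA _).trans_le (min_le_right _ _)), fun n => hu _, fun n => ?_⟩
  have h1 := hεu (x n)
  have h2 := T.le_opNorm_of_le (hfA n)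
  have h3 : (‖T‖ + 1) * (ε / (2 * (‖T‖ + 1))) = ε / 2 := by field_simp
  rw [map_sub] at h2
  have h4 := norm_sub_norm_le (T (bandProj 𝕜 p (hA (x n)) (u (x n))))
    (T (bandProj 𝕜 p (hA' n) (u (x n))))
  linarith

/-- An operator whose range does not vanish on small sets has a large image on a sequence of
disjoint bands. -/
theorem exists_disjoint_targets {𝕜 : Type*} [RCLike 𝕜] {p : ℝ≥0∞} [Fact (1 ≤ p)]
    (hp : p ≠ ∞) (T : UnitLp 𝕜 p →L[𝕜] UnitLp 𝕜 p) {ε : ℝ} (hε : 0 < ε)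
    (h : ∀ δ : ℝ≥0∞, 0 < δ → ∃ (A : Set I) (hA : MeasurableSet A) (u : UnitLp 𝕜 p),
      volume A < δ ∧ ‖u‖ ≤ 1 ∧ ε ≤ ‖bandProj 𝕜 p hA (T u)‖) {δ : ℝ≥0∞} (hδ : 0 < δ) :
    ∃ (A : ℕ → Set I) (hA : ∀ n, MeasurableSet (A n)) (u : ℕ → UnitLp 𝕜 p),
      (Pairwise fun m n => Disjoint (A m) (A n)) ∧ (∀ n, volume (A n) < δ) ∧ (∀ n, ‖u n‖ ≤ 1) ∧
      ∀ n, ε / 2 ≤ ‖bandProj 𝕜 p (hA n) (T (u n))‖ := by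
  have h' : ∀ γ : {γ : ℝ≥0∞ // 0 < γ}, _ := fun γ => h (min γ.1 δ) (lt_min γ.2 hδ)
  choose A hA u hvA hu hεu using h'
  obtain ⟨x, A', -, hA', -, hd, -, hsub, hfA, -⟩ := exists_disjoint_subseq hp hA hA
    (fun a => T (u a)) (fun a => T (u a))
    (fun γ hγ => ⟨⟨γ, hγ⟩, (hvA _).trans_le (min_le_left _ _),
      (hvA _).trans_le (min_le_left _ _)⟩) (half_pos hε)
  refine ⟨A', hA', fun n => u (x n), hd, fun n => (measure_mono (hsub n)).trans_lt
    ((hvA _).trans_le (min_le_right _ _)), fun n => hu _, fun n => ?_⟩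
  have h1 := hεu (x n)
  have h2 := hfA n
  have h4 := norm_sub_norm_le (bandProj 𝕜 p (hA (x n)) (T (u (x n))))
    (bandProj 𝕜 p (hA' n) (T (u (x n))))
  linarith

theorem exists_div_rpow_lt {δ : ℝ≥0∞} (hδ : 0 < δ) (b : ℝ) {r : ℝ} (hr : 0 < r) :
    ∃ M : ℝ, 0 < M ∧ ENNReal.ofReal ((b / M) ^ r) < δ := by
  have h1 : Tendsto (fun M : ℝ => ENNReal.ofReal ((b / M) ^ r)) atTop (𝓝 0) := by
    have h2 : Tendsto (fun M : ℝ => b / M) atTop (𝓝 0) := tendsto_const_nhds.div_atTop tendsto_id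
    have h3 := h2.rpow_const (p := r) (Or.inr hr.le)
    rw [Real.zero_rpow hr.ne'] at h3
    simpa using ENNReal.tendsto_ofReal h3
  obtain ⟨M, hM, hM0⟩ := ((h1.eventually_lt_const hδ).and (eventually_gt_atTop 0)).exists
  exact ⟨M, hM0, hM⟩

/-- Signed sums of the disjoint sources have `L_p` norm at most `N ^ (1 / p)`, hence so do their
images in `L_2` up to `‖T‖`. Some image is then tiny in `L_2` but not in `L_p`, so it is
concentrated on a small set, which serves as the target. -/
theorem not_isSingularFor_of_sources_of_two_lt {𝕜 : Type*} [RCLike 𝕜] {p : ℝ≥0∞} [Fact (1 ≤ p)]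
    (hp2 : 2 < p) (hp : p ≠ ∞) (T : UnitLp 𝕜 p →L[𝕜] UnitLp 𝕜 p) {ε : ℝ} (hε : 0 < ε)
    (h : ∀ δ : ℝ≥0∞, 0 < δ → ∃ (A : Set I) (hA : MeasurableSet A) (u : UnitLp 𝕜 p),
      volume A < δ ∧ ‖u‖ ≤ 1 ∧ ε ≤ ‖T (bandProj 𝕜 p hA u)‖) :
    ¬ IsSingularFor 𝕜 (SeqLp 𝕜 p) T := by
  have hp0 := toReal_pos_of_fact hp
  have hpr : 2 < p.toReal := by
    simpa using (ENNReal.toReal_lt_toReal (by simp) hp).2 hp2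
  refine not_isSingularFor_of_small_bands (ENNReal.one_lt_two.trans hp2) hp T (c := ε / 4)
    (by positivity) fun δ hδ => ?_
  obtain ⟨A, hA, u, hd, hvA, hu, hlow⟩ := exists_disjoint_sources hp T hε h hδ
  obtain ⟨ι, hι, hιn⟩ := exists_inclusion 𝕜 hp2.le
  obtain ⟨M, hM0, hM⟩ := exists_div_rpow_lt hδ 1 (r := 2) two_pos
  have hsigned : ∀ (N : ℕ) (s : ℕ → 𝕜), (∀ n, ‖s n‖ ≤ 1) →
      ‖∑ n ∈ Finset.range N, s n • ι (T (bandProj 𝕜 p (hA n) (u n)))‖ ≤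
        ‖T‖ * (N : ℝ) ^ p.toReal⁻¹ := by
    intro N s hs
    have hsum : ∑ n ∈ Finset.range N, s n • ι (T (bandProj 𝕜 p (hA n) (u n))) =
        ι (T (∑ n ∈ Finset.range N, s n • bandProj 𝕜 p (hA n) (u n))) := by
      simp only [map_sum, map_smul]
    have hup := norm_sum_smul_bandProj_le hp hA hd hu (Finset.range N) s
    rw [hsum]
    refine (hιn _).trans (T.le_opNorm_of_le ?_)
    rw [Real.le_rpow_inv_iff_of_pos (norm_nonneg _) (Nat.cast_nonneg _) hp0]
    refine hup.trans ?_
    calc ∑ n ∈ Finset.range N, ‖s n‖ ^ p.toReal ≤ ∑ n ∈ Finset.range N, (1 : ℝ) :=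
          Finset.sum_le_sum fun n _ => Real.rpow_le_one (norm_nonneg _) (hs n) hp0.le
      _ = N := by simp
  have hr : p.toReal⁻¹ < 1 / 2 := by
    rw [one_div]
    exact inv_strictAnti₀ two_pos hpr
  -- With this `η`, Chebyshev at level `ε / 4` in `L_2` bounds the measure by `(1 / M) ^ 2 < δ`. Off
  -- that set the image has norm at most `ε / 4`, which leaves `ε / 4` of the lower bound `ε / 2`.
  obtain ⟨n, hn⟩ := exists_norm_lt_of_signed_sums (𝕜 := 𝕜) _ hr hsigned
    (η := ε / 4 / M) (by positivity)
  set y := T (bandProj 𝕜 p (hA n) (u n)) with hy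
  refine ⟨A n, {t | ε / 4 < ‖y t‖}, hA n, measurableSet_lt_norm y _, u n, hvA n, ?_, hu n, ?_⟩
  · have h1 : volume {t | ε / 4 < ‖y t‖} = volume {t | ε / 4 < ‖ι y t‖} := by
      refine measure_congr ?_
      filter_upwards [hι y] with t ht
      change (ε / 4 < ‖y t‖) = (ε / 4 < ‖ι y t‖)
      rw [ht]
    rw [h1]
    refine (volume_lt_norm_le (by simp) (ι y) (by positivity)).trans_lt (hM.trans_le' ?_)
    refine ENNReal.ofReal_le_ofReal ?_
    rw [ENNReal.toReal_ofNat]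
    refine Real.rpow_le_rpow (by positivity) ?_ two_pos.le
    rw [div_le_div_iff₀ (by positivity) hM0, one_mul]
    exact ((lt_div_iff₀ hM0).1 hn).le
  · have h1 := norm_sub_bandProj_le y (c := ε / 4) (by positivity)
    have h2 := hlow n
    have h3 := norm_sub_norm_le y (bandProj 𝕜 p (measurableSet_lt_norm y (ε / 4)) y)
    rw [← hy] at h2
    linarith

/-- No second small band is needed: with `Φ` the adjoint of `T V`, the diagonal entries of `Φ T V`
are `‖T V e_n‖ ^ 2`. -/
theorem not_isSingularFor_of_sources_two {𝕜 : Type*} [RCLike 𝕜] [Fact ((1 : ℝ≥0∞) ≤ 2)]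
    (T : UnitLp 𝕜 2 →L[𝕜] UnitLp 𝕜 2) {ε : ℝ} (hε : 0 < ε)
    (h : ∀ δ : ℝ≥0∞, 0 < δ → ∃ (A : Set I) (hA : MeasurableSet A) (u : UnitLp 𝕜 2),
      volume A < δ ∧ ‖u‖ ≤ 1 ∧ ε ≤ ‖T (bandProj 𝕜 2 hA u)‖) :
    ¬ IsSingularFor 𝕜 (SeqLp 𝕜 2) T := by
  obtain ⟨A, hA, u, hd, -, hu, hlow⟩ :=
    exists_disjoint_sources ENNReal.ofNat_ne_top T hε h one_pos
  obtain ⟨V, hV⟩ := exists_disjoint_synthesis ENNReal.ofNat_ne_top hA hd hu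
  refine not_isSingularFor_of_factor ENNReal.one_lt_two ENNReal.ofNat_ne_top T V
    (ContinuousLinearMap.adjoint (T.comp V)) (c := (ε / 2) ^ 2) (by positivity) fun n => ?_
  have h1 : (ContinuousLinearMap.adjoint (T.comp V) (T (V (unitVec 𝕜 2 n)))) n =
      inner 𝕜 (T (V (unitVec 𝕜 2 n))) (T (V (unitVec 𝕜 2 n))) := by
    have h2 := lp.inner_single_left (𝕜 := 𝕜) (G := fun _ : ℕ => 𝕜) n (1 : 𝕜)
      (ContinuousLinearMap.adjoint (T.comp V) (T (V (unitVec 𝕜 2 n))))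
    rw [ContinuousLinearMap.adjoint_inner_right] at h2
    simpa using h2.symm
  rw [h1, inner_self_eq_norm_sq_to_K, norm_pow, RCLike.norm_ofReal, abs_norm, hV]
  exact pow_le_pow_left₀ (by positivity) (hlow n) 2

/-- Dual to the case `p > 2`: functionals norming the disjoint targets are pulled back through `T`
and restricted to `L_2`. Some restriction is tiny, so the bounded part of `u n` contributes little,
and the part where `u n` is large serves as the source. -/
theorem not_isSingularFor_of_targets_of_lt_two {𝕜 : Type*} [RCLike 𝕜] {p : ℝ≥0∞} [Fact (1 ≤ p)]
    (hp1 : 1 < p) (hp2 : p < 2) (T : UnitLp 𝕜 p →L[𝕜] UnitLp 𝕜 p) {ε : ℝ} (hε : 0 < ε)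
    (h : ∀ δ : ℝ≥0∞, 0 < δ → ∃ (A : Set I) (hA : MeasurableSet A) (u : UnitLp 𝕜 p),
      volume A < δ ∧ ‖u‖ ≤ 1 ∧ ε ≤ ‖bandProj 𝕜 p hA (T u)‖) :
    ¬ IsSingularFor 𝕜 (SeqLp 𝕜 p) T := by
  have hp : p ≠ ∞ := (hp2.trans ENNReal.ofNat_lt_top).ne
  have hp0 := toReal_pos_of_fact hp
  have hpr1 : 1 < p.toReal := by
    simpa using (ENNReal.toReal_lt_toReal ENNReal.one_ne_top hp).2 hp1
  have hpr2 : p.toReal < 2 := by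
    simpa using (ENNReal.toReal_lt_toReal hp (by simp)).2 hp2
  refine not_isSingularFor_of_small_bands hp1 hp T (c := ε / 4) (by positivity) fun δ hδ => ?_
  obtain ⟨A, hA, u, hd, hvA, hu, hlow⟩ := exists_disjoint_targets hp T hε h hδ
  obtain ⟨ι, hι, hιn⟩ := exists_inclusion 𝕜 hp2.le
  obtain ⟨M, hM0, hM⟩ := exists_div_rpow_lt hδ 1 hp0
  choose ψ hψ hψe using fun n => exists_dual_vector'' 𝕜 (bandProj 𝕜 p (hA n) (T (u n)))
  let θ : ℕ → UnitLp 𝕜 2 →L[𝕜] 𝕜 := fun n => ((ψ n).comp (bandProj 𝕜 p (hA n))).comp (T.comp ι)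
  -- Riesz representatives turn the functionals into vectors to which the signed-sum bound applies.
  let y : ℕ → UnitLp 𝕜 2 := fun n => (InnerProductSpace.toDual 𝕜 (UnitLp 𝕜 2)).symm (θ n)
  have hyθ : ∀ n g, inner 𝕜 (y n) g = ψ n (bandProj 𝕜 p (hA n) (T (ι g))) := fun n g =>
    InnerProductSpace.toDual_symm_apply
  have hsum : ∀ (N : ℕ) (g : UnitLp 𝕜 2), ∑ n ∈ Finset.range N, ‖(inner 𝕜 (y n) g : 𝕜)‖ ≤
      ‖T‖ * (N : ℝ) ^ (1 - p.toReal⁻¹) * ‖g‖ := by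
    intro N g
    have hle : ∀ n, ‖(inner 𝕜 (y n) g : 𝕜)‖ ≤ ‖bandProj 𝕜 p (hA n) (T (ι g))‖ := fun n => by
      rw [hyθ]
      simpa using (ψ n).le_of_opNorm_le (hψ n) (bandProj 𝕜 p (hA n) (T (ι g)))
    -- Hölder over `N` terms turns the `ℓ_p` bound for disjoint bands into an `ℓ_1` bound with
    -- factor `N ^ (1 - 1 / p)`.
    have h1 := Real.rpow_sum_le_const_mul_sum_rpow_of_nonneg (Finset.range N) hpr1.le
      (f := fun n => ‖bandProj 𝕜 p (hA n) (T (ι g))‖) fun _ _ => norm_nonneg _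
    have h2 := sum_norm_bandProj_rpow_le hp hA hd (T (ι g)) (Finset.range N)
    have h3 : (∑ n ∈ Finset.range N, ‖bandProj 𝕜 p (hA n) (T (ι g))‖) ≤
        (N : ℝ) ^ (1 - p.toReal⁻¹) * ‖T (ι g)‖ := by
      rw [← Real.rpow_le_rpow_iff (Finset.sum_nonneg fun _ _ => norm_nonneg _) (by positivity) hp0,
        Real.mul_rpow (by positivity) (norm_nonneg _), ← Real.rpow_mul (Nat.cast_nonneg N),
        sub_mul, one_mul, inv_mul_cancel₀ hp0.ne']
      rw [Finset.card_range] at h1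
      exact h1.trans (mul_le_mul_of_nonneg_left h2 (by positivity))
    calc ∑ n ∈ Finset.range N, ‖(inner 𝕜 (y n) g : 𝕜)‖
        ≤ (N : ℝ) ^ (1 - p.toReal⁻¹) * ‖T (ι g)‖ :=
          (Finset.sum_le_sum fun n _ => hle n).trans h3
      _ ≤ (N : ℝ) ^ (1 - p.toReal⁻¹) * (‖T‖ * ‖g‖) :=
          mul_le_mul_of_nonneg_left (T.le_opNorm_of_le (hιn g)) (by positivity)
      _ = _ := by ring
  have hsigned : ∀ (N : ℕ) (s : ℕ → 𝕜), (∀ n, ‖s n‖ ≤ 1) →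
      ‖∑ n ∈ Finset.range N, s n • y n‖ ≤ ‖T‖ * (N : ℝ) ^ (1 - p.toReal⁻¹) := by
    intro N s hs
    set g := ∑ n ∈ Finset.range N, s n • y n with hg
    rcases (norm_nonneg g).eq_or_lt' with h0 | h0
    · rw [h0]
      positivity
    refine le_of_mul_le_mul_right ?_ h0
    refine le_trans ?_ (hsum N g)
    have h1 : ‖g‖ * ‖g‖ = ‖(inner 𝕜 g g : 𝕜)‖ := by
      rw [inner_self_eq_norm_sq_to_K, norm_pow, RCLike.norm_ofReal, abs_norm, sq]
    rw [h1]
    nth_rewrite 1 [hg]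
    rw [sum_inner]
    refine norm_sum_le_of_le _ fun n _ => ?_
    rw [inner_smul_left, norm_mul, RCLike.norm_conj]
    exact mul_le_of_le_one_left (norm_nonneg _) (hs n)
  have hr : 1 - p.toReal⁻¹ < 1 / 2 := by
    have : (2 : ℝ)⁻¹ < p.toReal⁻¹ := inv_strictAnti₀ hp0 hpr2
    linarith
  obtain ⟨n, hn⟩ := exists_norm_lt_of_signed_sums (𝕜 := 𝕜) y hr hsigned
    (η := ε / 4 / M) (by positivity)
  -- Chebyshev bounds the source by `(1 / M) ^ p < δ`. The truncation of `u n` at level `M`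
  -- contributes at most `‖y n‖ * M ≤ ε / 4` to the norming functional.
  refine ⟨{t | M < ‖u n t‖}, A n, measurableSet_lt_norm _ _, hA n, u n, ?_, hvA n, hu n, ?_⟩
  · refine (volume_lt_norm_le hp (u n) hM0).trans_lt (hM.trans_le' ?_)
    refine ENNReal.ofReal_le_ofReal (Real.rpow_le_rpow (by positivity) ?_ hp0.le)
    exact div_le_div_of_nonneg_right (hu n) hM0.le
  · obtain ⟨g, hg, hge⟩ := exists_truncation 2 (u n) hM0.le
    set w := bandProj 𝕜 p (measurableSet_lt_norm (u n) M) (u n)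
    have hιg : ι g = u n - w := Lp.ext ((hι g).trans hge.symm)
    have h1 : ‖ψ n (bandProj 𝕜 p (hA n) (T (u n - w)))‖ ≤ ε / 4 := by
      rw [← hιg, ← hyθ]
      calc ‖(inner 𝕜 (y n) g : 𝕜)‖ ≤ ‖y n‖ * ‖g‖ := norm_inner_le_norm _ _
        _ ≤ ε / 4 / M * M := mul_le_mul hn.le hg (norm_nonneg _) (by positivity)
        _ = ε / 4 := div_mul_cancel₀ _ hM0.ne'
    have h2 : ‖ψ n (bandProj 𝕜 p (hA n) (T w))‖ ≤ ‖bandProj 𝕜 p (hA n) (T w)‖ := by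
      simpa using (ψ n).le_of_opNorm_le (hψ n) (bandProj 𝕜 p (hA n) (T w))
    have h3 : ‖ψ n (bandProj 𝕜 p (hA n) (T (u n)))‖ = ‖bandProj 𝕜 p (hA n) (T (u n))‖ := by
      rw [hψe, RCLike.norm_ofReal, abs_norm]
    have h4 := norm_sub_norm_le (ψ n (bandProj 𝕜 p (hA n) (T (u n))))
      (ψ n (bandProj 𝕜 p (hA n) (T w)))
    rw [map_sub, map_sub, map_sub] at h1
    have h5 := hlow n
    linarith

/-! ### Conclusion -/

/-- Failure of uniform smallness on sets of small measure. -/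
theorem exists_small_of_not {𝕜 : Type*} [RCLike 𝕜] {p : ℝ≥0∞} [Fact (1 ≤ p)]
    (S : ∀ A : Set I, MeasurableSet A → (UnitLp 𝕜 p →L[𝕜] UnitLp 𝕜 p)) {ε : ℝ}
    (h : ¬ ∃ δ : ℝ, 0 < δ ∧ ∀ (A : Set I) (hA : MeasurableSet A), volume.real A < δ →
      ‖S A hA‖ ≤ ε) (δ : ℝ≥0∞) (hδ : 0 < δ) :
    ∃ (A : Set I) (hA : MeasurableSet A) (u : UnitLp 𝕜 p),
      volume A < δ ∧ ‖u‖ ≤ 1 ∧ ε ≤ ‖S A hA u‖ := by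
  push Not at h
  -- The cap at `1` covers `δ = ∞`, for which `toReal` would be zero.
  have hmin : min δ 1 ≠ ∞ := ((min_le_right _ _).trans_lt ENNReal.one_lt_top).ne
  obtain ⟨A, hA, hvA, hlt⟩ := h (min δ 1).toReal
    (ENNReal.toReal_pos (lt_min hδ one_pos).ne' hmin)
  obtain ⟨u, hu, hεu⟩ := (S A hA).exists_lt_apply_of_lt_opNorm hlt
  refine ⟨A, hA, u, ?_, hu.le, hεu.le⟩
  exact ((ENNReal.toReal_lt_toReal (measure_ne_top _ _) hmin).1 hvA).trans_le (min_le_left _ _)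

theorem proposition6p12 {𝕜 : Type*} [RCLike 𝕜] (p : ℝ≥0∞) [Fact (1 ≤ p)]
    (hp_one : 1 < p) (hp_top : p < ∞)
    (T : UnitLp 𝕜 p →L[𝕜] UnitLp 𝕜 p) (hT : IsSingularFor 𝕜 (SeqLp 𝕜 p) T) :
    (p < 2 → ∀ ε : ℝ, 0 < ε → ∃ δ : ℝ, 0 < δ ∧
      ∀ (A : Set I) (hA : MeasurableSet A), volume.real A < δ →
        ‖(bandProj 𝕜 p hA).comp T‖ ≤ ε) ∧
    (2 ≤ p → ∀ ε : ℝ, 0 < ε → ∃ δ : ℝ, 0 < δ ∧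
      ∀ (A : Set I) (hA : MeasurableSet A), volume.real A < δ →
        ‖T.comp (bandProj 𝕜 p hA)‖ ≤ ε) := by
  refine ⟨fun hp2 ε hε => ?_, fun hp2 ε hε => ?_⟩
  · by_contra hcon
    exact not_isSingularFor_of_targets_of_lt_two hp_one hp2 T hε
      (exists_small_of_not (fun A hA => (bandProj 𝕜 p hA).comp T) hcon) hT
  · by_contra hcon
    have hsmall := exists_small_of_not (fun A hA => T.comp (bandProj 𝕜 p hA)) hcon
    rcases hp2.eq_or_lt with rfl | hlt
    · exact not_isSingularFor_of_sources_two T hε hsmall hT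
    · exact not_isSingularFor_of_sources_of_two_lt hlt hp_top.ne T hε hsmall hT
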